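/- For a permutation $\pi$ of $\{1,\dots,n\}$ let $d(\pi)=|\{1\le i\le n-1 : \pi(i)>\pi(i+1)\}|$ be its descent number. For a partition $\lambda\vdash n$ let $\mathcal C_\lambda\subseteq S_n$ be the conjugacy class of the permutations with cycle lengths $\lambda$ (fixed points counted as cycles of length $1$), let $m_1(\lambda)$ be the number of parts of $\lambda$ equal to $1$, and let $D_\lambda=d(\pi)$ for $\pi$ uniformly distributed on $\mathcal C_\lambda$. Lemma. Let $\lambda$ vary over partitions of integers $n$ in such a way that $n\to\infty$ and $m_1(\lambda)/n\to\alpha$. Then the asymptotic variance of $D_\lambda$ is $(1-4\alpha^3+3\alpha^4)\,\frac{n}{12}$; that is, \[ \operatorname{Var}(D_\lambda) = \left(1-4\alpha^3+3\alpha^4\right)\frac{n}{12} + o(n), \qquad\text{equivalently}\qquad \frac{\operatorname{Var}(D_\lambda)}{n}\longrightarrow\frac{1-4\alpha^3+3\alpha^4}{12}, \] and in particular, if $\alpha<1$, $\operatorname{Var}(D_\lambda)\sim(1-4\alpha^3+3\alpha^4)\,\frac{n}{12}$. -/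

import Mathlib

/-- The descent set of a permutation `π` of `{0, …, n - 1}`: the positions `i` that have a
successor `i + 1 < n` and satisfy `π (i + 1) < π i`. -/
def descentSet {n : ℕ} (π : Equiv.Perm (Fin n)) : Finset (Fin n) :=
  {i | ∃ h : (i : ℕ) + 1 < n, π ⟨i + 1, h⟩ < π i}

/-- The descent number `d(π)`. -/
def descentNumber {n : ℕ} (π : Equiv.Perm (Fin n)) : ℕ :=
  (descentSet π).card

/-- The conjugacy class `C_p` of `S_n`: the permutations whose cycle lengths, fixed points
counted as cycles of length one, are the parts of `p`. -/
def cycleClass {n : ℕ} (p : n.Partition) : Finset (Equiv.Perm (Fin n)) :=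
  {π | π.partition.parts = p.parts}

/-- The number `m_i` of parts of `p` equal to `i`. -/
def partMult {n : ℕ} (p : n.Partition) (i : ℕ) : ℕ :=
  p.parts.count i

/-- The variance of `d(π)`, where `π` is uniformly distributed on `C_p`. The finite set `S_n`
carries the discrete σ-algebra. -/
noncomputable def descentVariance {n : ℕ} (p : n.Partition) : ℝ :=
  letI : MeasurableSpace (Equiv.Perm (Fin n)) := ⊤
  ProbabilityTheory.variance (fun π : Equiv.Perm (Fin n) => (descentNumber π : ℝ))
    (ProbabilityTheory.uniformOn (cycleClass p : Set (Equiv.Perm (Fin n))))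

open Finset Equiv
open scoped BigOperators

/-! Attach to each pair of consecutive points the sign +1 for a descent and -1 for an ascent
(`descSign`). The descent number is half the sum of these signs plus a constant, so its variance is
a quarter of that of the sum (`descExcess`). A conjugacy class is invariant under conjugation by
transpositions, and everything is extracted from that symmetry.

Conjugating by the transposition of `a` and `a + 1` flips their sign unless `π` preserves the pair;
hence a sign may be replaced in the mean by `pairSign`. For disjoint pairs the same replacement in a
product costs O(1/n²) (`abs_expect_descSign_mul_sub_le`). For overlapping pairs, averaging over the
conjugates by a 3-cycle gives -1/3 + (4/3) P(all three fixed) + O(1/n)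
(`abs_expect_descSign_adjacent_le`). By exchangeability, the probability of fixing k given points is
a ratio of falling factorials in the number F of fixed points and in n (`expect_mul_fixed`).

Summing, the variance of the sum is `mainVariance` + O(1), uniformly in the class
(`abs_variance_descExcess_sub_le`). The 2-cycles enter only through the probability q of exchanging
two given points, and q cancels up to O(1) (`second_moment_identity`). After division by n the
diagonal contributes 1, the overlapping pairs -2/3 + 8α³/3, and the disjoint pairs minus the squared
mean α⁴ - 4α³. The total is (1 - 4α³ + 3α⁴)/3. -/

/-- The real indicator of a proposition. -/
noncomputable def indic (P : Prop) : ℝ := open Classical in if P then 1 else 0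

lemma indic_true {P : Prop} (h : P) : indic P = 1 := if_pos h

lemma indic_false {P : Prop} (h : ¬ P) : indic P = 0 := if_neg h

lemma indic_nonneg (P : Prop) : 0 ≤ indic P := by
  unfold indic; split_ifs <;> norm_num

lemma indic_le_one (P : Prop) : indic P ≤ 1 := by
  unfold indic; split_ifs <;> norm_num

lemma indic_mul (P Q : Prop) : indic P * indic Q = indic (P ∧ Q) := by
  by_cases hP : P <;> by_cases hQ : Q <;> simp [indic, hP, hQ]

lemma indic_or_le (P Q : Prop) : indic (P ∨ Q) ≤ indic P + indic Q := by
  by_cases hP : P <;> by_cases hQ : Q <;> simp [indic, hP, hQ]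

lemma indic_mono {P Q : Prop} (h : P → Q) : indic P ≤ indic Q := by
  by_cases hP : P
  · rw [indic_true hP, indic_true (h hP)]
  · rw [indic_false hP]; exact indic_nonneg Q

/-! ### Exchangeability under conjugation -/

/-- A set of permutations closed under conjugation by transpositions. -/
def ConjClosed {n : ℕ} (C : Finset (Perm (Fin n))) : Prop :=
  ∀ x y : Fin n, ∀ π ∈ C, swap x y * π * swap x y ∈ C

lemma swap_conj_apply {n : ℕ} (x y z : Fin n) (π : Perm (Fin n)) :
    (swap x y * π * swap x y) z = swap x y (π (swap x y z)) := rfl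

lemma swap_conj_conj {n : ℕ} (x y : Fin n) (π : Perm (Fin n)) :
    swap x y * (swap x y * π * swap x y) * swap x y = π := by
  ext z; simp

lemma expect_swap_conj {n : ℕ} {C : Finset (Perm (Fin n))} (hC : ConjClosed C) (x y : Fin n)
    (g : Perm (Fin n) → ℝ) :
    𝔼 π ∈ C, g (swap x y * π * swap x y) = 𝔼 π ∈ C, g π := by
  refine Finset.expect_nbij' (fun π => swap x y * π * swap x y)
    (fun π => swap x y * π * swap x y) ?_ ?_ ?_ ?_ ?_
  · intro π hπ; exact hC x y π hπ
  · intro π hπ; exact hC x y π hπ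
  · intro π _; exact swap_conj_conj x y π
  · intro π _; exact swap_conj_conj x y π
  · intro π _; rfl

/-- Averaging an equivariant statistic of a point over all points outside `S`. -/
lemma card_mul_expect_point {n : ℕ} {C : Finset (Perm (Fin n))} (hC : ConjClosed C)
    (S : Finset (Fin n)) (h : Perm (Fin n) → Fin n → ℝ)
    (hh : ∀ x ∉ S, ∀ y ∉ S, ∀ π ∈ C, h (swap x y * π * swap x y) y = h π x)
    {x : Fin n} (hx : x ∉ S) :
    ((n : ℝ) - S.card) * 𝔼 π ∈ C, h π x = 𝔼 π ∈ C, ∑ y ∈ Sᶜ, h π y := by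
  rw [Finset.expect_sum_comm]
  have h1 : ∀ y ∈ Sᶜ, 𝔼 π ∈ C, h π y = 𝔼 π ∈ C, h π x := by
    intro y hy
    rw [← expect_swap_conj hC x y]
    exact Finset.expect_congr rfl fun π hπ => hh x hx y (by simpa using hy) π hπ
  rw [Finset.sum_congr rfl h1, Finset.sum_const, Finset.card_compl, Fintype.card_fin,
    nsmul_eq_mul, Nat.cast_sub (by simpa using Finset.card_le_univ S)]

/-- The number of fixed points. -/
noncomputable def fixCount {n : ℕ} (π : Perm (Fin n)) : ℝ := ∑ x, indic (π x = x)

/-- On the support of `g`, the set `S` uses up `s` of the `F` fixed points. The others are spread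
evenly over the complement of `S`, so each point there is fixed with conditional probability (F -
s)/(n - |S|). -/
lemma expect_mul_fixed {n : ℕ} {C : Finset (Perm (Fin n))} (hC : ConjClosed C) {F : ℝ}
    (hF : ∀ π ∈ C, fixCount π = F) (S : Finset (Fin n)) (g : Perm (Fin n) → ℝ) (s : ℝ)
    (hg : ∀ x ∉ S, ∀ y ∉ S, ∀ π, g (swap x y * π * swap x y) = g π)
    (hs : ∀ π, g π ≠ 0 → ∑ x ∈ S, indic (π x = x) = s) {x : Fin n} (hx : x ∉ S) :
    ((n : ℝ) - S.card) * 𝔼 π ∈ C, g π * indic (π x = x) = (F - s) * 𝔼 π ∈ C, g π := by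
  rw [card_mul_expect_point hC S (fun π x => g π * indic (π x = x)) _ hx, Finset.mul_expect]
  · refine Finset.expect_congr rfl fun π hπ => ?_
    rw [← Finset.mul_sum]
    by_cases h0 : g π = 0
    · simp [h0]
    · have := Finset.sum_add_sum_compl S (fun x => indic (π x = x))
      rw [hs π h0] at this
      have h2 : ∑ x ∈ Sᶜ, indic (π x = x) = F - s := by
        rw [← hF π hπ, fixCount]; linarith
      rw [h2]; ring
  · intro x hx y hy π _
    simp only [hg x hx y hy, swap_conj_apply, swap_apply_right]
    congr 2
    rw [eq_iff_iff, Equiv.swap_apply_eq_iff, swap_apply_right]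

/-- All points outside `S` are equally likely as images of `a`, and these disjoint events have total
probability at most one. -/
lemma expect_mul_map_le {n : ℕ} {C : Finset (Perm (Fin n))} (hC : ConjClosed C)
    (S : Finset (Fin n)) (g : Perm (Fin n) → ℝ) (hg0 : ∀ π, 0 ≤ g π)
    (hg : ∀ x ∉ S, ∀ y ∉ S, ∀ π, g (swap x y * π * swap x y) = g π)
    {a x : Fin n} (ha : a ∈ S) (hx : x ∉ S) :
    ((n : ℝ) - S.card) * 𝔼 π ∈ C, g π * indic (π a = x) ≤ 𝔼 π ∈ C, g π := by
  rw [card_mul_expect_point hC S (fun π x => g π * indic (π a = x)) _ hx]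
  · refine Finset.expect_le_expect fun π hπ => ?_
    rw [← Finset.mul_sum]
    refine mul_le_of_le_one_right (hg0 π) ?_
    calc ∑ y ∈ Sᶜ, indic (π a = y) ≤ ∑ y, indic (π a = y) :=
          Finset.sum_le_sum_of_subset_of_nonneg (Finset.subset_univ _)
            fun _ _ _ => indic_nonneg _
      _ = 1 := by
          rw [Finset.sum_eq_single (π a) (fun y _ hy => indic_false (Ne.symm hy)) (by simp)]
          exact indic_true rfl
  · intro x hx y hy π _
    have hax : a ≠ x := fun h => hx (h ▸ ha)
    have hay : a ≠ y := fun h => hy (h ▸ ha)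
    simp only [hg x hx y hy, swap_conj_apply, swap_apply_of_ne_of_ne hax hay]
    congr 2
    rw [eq_iff_iff, Equiv.swap_apply_eq_iff, swap_apply_right]

/-! ### Probabilities of local patterns -/

section Patterns

variable {n : ℕ} {C : Finset (Perm (Fin n))}

lemma swap_conj_apply_eq_iff {S : Finset (Fin n)} {x y a b : Fin n} (hx : x ∉ S) (hy : y ∉ S)
    (ha : a ∈ S) (hb : b ∈ S) (π : Perm (Fin n)) :
    (swap x y * π * swap x y) a = b ↔ π a = b := by
  rw [swap_conj_apply, swap_apply_of_ne_of_ne (ne_of_mem_of_not_mem ha hx)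
    (ne_of_mem_of_not_mem ha hy), Equiv.swap_apply_eq_iff,
    swap_apply_of_ne_of_ne (ne_of_mem_of_not_mem hb hx) (ne_of_mem_of_not_mem hb hy)]

lemma expect_fixed_one (hC : ConjClosed C) (hne : C.Nonempty) {F : ℝ}
    (hF : ∀ π ∈ C, fixCount π = F) (a : Fin n) :
    (n : ℝ) * 𝔼 π ∈ C, indic (π a = a) = F := by
  have := expect_mul_fixed hC hF ∅ (fun _ => 1) 0 (by simp) (by simp) (x := a) (by simp)
  simpa [Finset.expect_const hne] using this

lemma expect_fixed_two (hC : ConjClosed C) (hne : C.Nonempty) {F : ℝ}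
    (hF : ∀ π ∈ C, fixCount π = F) {a b : Fin n} (hab : a ≠ b) :
    (n : ℝ) * (n - 1) * 𝔼 π ∈ C, indic (π a = a ∧ π b = b) = F * (F - 1) := by
  have := expect_mul_fixed hC hF {a} (fun π => indic (π a = a)) 1
    (by
      intro x hx y hy π
      simp only [swap_conj_apply_eq_iff hx hy, mem_singleton])
    (by
      intro π h
      simpa [indic] using h) (x := b) (by simpa using hab.symm)
  simp only [indic_mul, card_singleton, Nat.cast_one] at this
  rw [mul_assoc, this, mul_left_comm, expect_fixed_one hC hne hF]
  ring

lemma expect_fixed_three (hC : ConjClosed C) (hne : C.Nonempty) {F : ℝ}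
    (hF : ∀ π ∈ C, fixCount π = F) {a b c : Fin n} (hab : a ≠ b) (hac : a ≠ c) (hbc : b ≠ c) :
    (n : ℝ) * (n - 1) * (n - 2) * 𝔼 π ∈ C, indic (π a = a ∧ π b = b ∧ π c = c)
      = F * (F - 1) * (F - 2) := by
  have := expect_mul_fixed hC hF {a, b} (fun π => indic (π a = a ∧ π b = b)) 2
    (by
      intro x hx y hy π
      simp only [swap_conj_apply_eq_iff hx hy, mem_insert, mem_singleton, true_or, or_true])
    (by
      intro π h
      have h' : π a = a ∧ π b = b := by
        by_contra h'; exact h (indic_false h')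
      rw [Finset.sum_pair hab, indic_true h'.1, indic_true h'.2]; norm_num)
    (x := c) (by simp [hac.symm, hbc.symm])
  simp only [indic_mul, card_pair hab, Nat.cast_ofNat, and_assoc] at this
  rw [mul_assoc, this, mul_left_comm, expect_fixed_two hC hne hF hab]
  ring

lemma expect_fixed_four (hC : ConjClosed C) (hne : C.Nonempty) {F : ℝ}
    (hF : ∀ π ∈ C, fixCount π = F) {a b c d : Fin n} (hab : a ≠ b) (hac : a ≠ c) (hbc : b ≠ c)
    (had : a ≠ d) (hbd : b ≠ d) (hcd : c ≠ d) :
    (n : ℝ) * (n - 1) * (n - 2) * (n - 3) *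
      𝔼 π ∈ C, indic (π a = a ∧ π b = b ∧ π c = c ∧ π d = d)
      = F * (F - 1) * (F - 2) * (F - 3) := by
  have := expect_mul_fixed hC hF {a, b, c} (fun π => indic (π a = a ∧ π b = b ∧ π c = c)) 3
    (by
      intro x hx y hy π
      simp only [swap_conj_apply_eq_iff hx hy, mem_insert, mem_singleton, true_or, or_true])
    (by
      intro π h
      have h' : π a = a ∧ π b = b ∧ π c = c := by
        by_contra h'; exact h (indic_false h')
      rw [Finset.sum_insert (by simp [hab, hac]), Finset.sum_pair hbc, indic_true h'.1,
        indic_true h'.2.1, indic_true h'.2.2]; norm_num)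
    (x := d) (by simp [had.symm, hbd.symm, hcd.symm])
  have hcard : ({a, b, c} : Finset (Fin n)).card = 3 := by
    rw [Finset.card_insert_of_notMem (by simp [hab, hac]), card_pair hbc]
  simp only [indic_mul, hcard, Nat.cast_ofNat, and_assoc] at this
  rw [mul_assoc, this, mul_left_comm, expect_fixed_three hC hne hF hab hac hbc]
  ring

/-- An exchanged pair occupies two points but no fixed point: the conditional probabilities are F/(n
- 2), then (F - 1)/(n - 3). -/
lemma expect_fixed_fixed_swapped (hC : ConjClosed C) {F : ℝ}
    (hF : ∀ π ∈ C, fixCount π = F) {a b c d : Fin n} (hab : a ≠ b) (hac : a ≠ c) (hbc : b ≠ c)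
    (had : a ≠ d) (hbd : b ≠ d) (hcd : c ≠ d) :
    ((n : ℝ) - 2) * (n - 3) *
      𝔼 π ∈ C, indic (π a = a ∧ π b = b) * indic (π c = d ∧ π d = c)
      = F * (F - 1) * 𝔼 π ∈ C, indic (π c = d ∧ π d = c) := by
  have h1 := expect_mul_fixed hC hF {c, d} (fun π => indic (π c = d ∧ π d = c)) 0
    (by
      intro x hx y hy π
      simp only [swap_conj_apply_eq_iff hx hy, mem_insert, mem_singleton, true_or, or_true])
    (by
      intro π h
      have h' : π c = d ∧ π d = c := by
        by_contra h'; exact h (indic_false h')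
      rw [Finset.sum_pair hcd, h'.1, h'.2, indic_false hcd.symm, indic_false hcd]; norm_num)
    (x := a) (by simp [hac, had])
  have h2 := expect_mul_fixed hC hF {c, d, a}
    (fun π => indic (π c = d ∧ π d = c) * indic (π a = a)) 1
    (by
      intro x hx y hy π
      simp only [swap_conj_apply_eq_iff hx hy, mem_insert, mem_singleton, true_or, or_true])
    (by
      intro π h
      rw [indic_mul] at h
      have h' : (π c = d ∧ π d = c) ∧ π a = a := by
        by_contra h'; exact h (indic_false h')
      rw [Finset.sum_insert (by simp [hcd, hac.symm]), Finset.sum_pair had.symm, h'.1.1, h'.1.2,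
        indic_false hcd.symm, indic_false hcd, indic_true h'.2]; norm_num)
    (x := b) (by simp [hbc, hbd, hab.symm])
  have hcard : ({c, d, a} : Finset (Fin n)).card = 3 := by
    rw [Finset.card_insert_of_notMem (by simp [hcd, hac.symm]), card_pair had.symm]
  simp only [hcard, card_pair hcd, Nat.cast_ofNat, sub_zero] at h1 h2
  have h3 : ∀ π : Perm (Fin n), indic (π a = a ∧ π b = b) * indic (π c = d ∧ π d = c)
      = indic (π c = d ∧ π d = c) * indic (π a = a) * indic (π b = b) := by
    intro π; simp only [indic_mul]; congr 1; rw [eq_iff_iff]; tauto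
  simp only [h3]
  rw [mul_assoc, h2, mul_left_comm, h1]
  ring

lemma expect_map_le (hC : ConjClosed C) (hne : C.Nonempty) {a b : Fin n} (hab : a ≠ b) :
    ((n : ℝ) - 1) * 𝔼 π ∈ C, indic (π a = b) ≤ 1 := by
  have := expect_mul_map_le hC {a} (fun _ => 1) (by simp) (by simp) (a := a) (x := b)
    (by simp) (by simpa using hab.symm)
  simpa [Finset.expect_const hne] using this

lemma expect_map_map_le (hC : ConjClosed C) (hne : C.Nonempty) {a b c d : Fin n}
    (hn : 3 ≤ n) (hab : a ≠ b) (hac : a ≠ c) (hbc : b ≠ c)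
    (had : a ≠ d) (hbd : b ≠ d) (hcd : c ≠ d) :
    ((n : ℝ) - 1) * (n - 3) * 𝔼 π ∈ C, indic (π a = b ∧ π c = d) ≤ 1 := by
  have := expect_mul_map_le hC {a, b, c} (fun π => indic (π a = b)) (fun _ => indic_nonneg _)
    (by
      intro x hx y hy π
      simp only [swap_conj_apply_eq_iff hx hy, mem_insert, mem_singleton, true_or, or_true]) (a := c) (x := d)
    (by simp) (by simp [had.symm, hbd.symm, hcd.symm])
  have hcard : ({a, b, c} : Finset (Fin n)).card = 3 := by
    rw [Finset.card_insert_of_notMem (by simp [hab, hac]), card_pair hbc]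
  simp only [indic_mul, hcard, Nat.cast_ofNat] at this
  have h1 := expect_map_le hC hne hab
  have hn' : (3 : ℝ) ≤ n := by exact_mod_cast hn
  nlinarith

/-- All pairs of points are equally likely to be exchanged. -/
lemma expect_swapped_eq (hC : ConjClosed C) (hn : 2 ≤ n) {a b c d : Fin n} (hab : a ≠ b)
    (hcd : c ≠ d) :
    𝔼 π ∈ C, indic (π a = b ∧ π b = a) = 𝔼 π ∈ C, indic (π c = d ∧ π d = c) := by
  have hn' : (2 : ℝ) ≤ n := by exact_mod_cast hn
  -- The right-hand side, the mean number of ordered exchanged pairs, does not involve `a` and `b`.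
  have key : ∀ a b : Fin n, a ≠ b → (n : ℝ) * (n - 1) * 𝔼 π ∈ C, indic (π a = b ∧ π b = a)
      = 𝔼 π ∈ C, ∑ x, ∑ y ∈ {x}ᶜ, indic (π x = y ∧ π y = x) := by
    intro a b hab
    have h1 := card_mul_expect_point hC {a} (fun π y => indic (π a = y ∧ π y = a))
      (by
        intro x hx y hy π _
        simp only [mem_singleton] at hx hy
        have hx' := Ne.symm hx
        have hy' := Ne.symm hy
        simp only [swap_conj_apply, swap_apply_of_ne_of_ne hx' hy', swap_apply_right,
          Equiv.swap_apply_eq_iff]) (x := b) (by simpa using hab.symm)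
    have h2 := card_mul_expect_point hC ∅
      (fun π x => ∑ y ∈ {x}ᶜ, indic (π x = y ∧ π y = x))
      (by
        intro x _ y _ π _
        refine Finset.sum_nbij' (swap x y) (swap x y) ?_ ?_ ?_ ?_ ?_
        · intro z hz
          simp only [mem_compl, mem_singleton] at hz ⊢
          rwa [Equiv.swap_apply_eq_iff, swap_apply_left]
        · intro z hz
          simp only [mem_compl, mem_singleton] at hz ⊢
          rwa [Equiv.swap_apply_eq_iff, swap_apply_right]
        · simp
        · simp
        · intro z _
          simp only [swap_conj_apply, swap_apply_right, Equiv.swap_apply_eq_iff]) (x := a)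
      (by simp)
    simp only [card_singleton, card_empty, Nat.cast_one, Nat.cast_zero, sub_zero,
      compl_empty] at h1 h2
    rw [mul_assoc, h1, h2]
  have h := (key a b hab).trans (key c d hcd).symm
  have h0 : (n : ℝ) * (n - 1) ≠ 0 := by
    have : 0 < (n : ℝ) * (n - 1) := by nlinarith
    exact this.ne'
  exact mul_left_cancel₀ h0 h

end Patterns

/-! ### Signs of consecutive pairs and their correlations -/

/-- `1` if `π` decreases from `a` to `b`, and `-1` otherwise. -/
noncomputable def descSign {n : ℕ} (a b : Fin n) (π : Perm (Fin n)) : ℝ :=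
  if π b < π a then 1 else -1

/-- `1` if `π` exchanges `a` and `b`, `-1` if it fixes both, and `0` otherwise. -/
noncomputable def pairSign {n : ℕ} (a b : Fin n) (π : Perm (Fin n)) : ℝ :=
  indic (π a = b ∧ π b = a) - indic (π a = a ∧ π b = b)

section Signs

variable {n : ℕ} {C : Finset (Perm (Fin n))}

lemma descSign_mul_self (a b : Fin n) (π : Perm (Fin n)) : descSign a b π * descSign a b π = 1 := by
  unfold descSign; split_ifs <;> norm_num

lemma abs_descSign (a b : Fin n) (π : Perm (Fin n)) : |descSign a b π| = 1 := by
  unfold descSign; split_ifs <;> norm_num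

/-- Conjugation by the transposition of two consecutive points reverses the sign, unless the pair
is preserved. -/
lemma descSign_add_swap_conj {a b : Fin n} (hab : (b : ℕ) = a + 1) (π : Perm (Fin n)) :
    descSign a b π + descSign a b (swap a b * π * swap a b) = 2 * pairSign a b π := by
  have hne : π a ≠ π b := fun h => by have := π.injective h; subst this; omega
  unfold descSign pairSign indic
  simp only [swap_conj_apply, swap_apply_left, swap_apply_right, swap_apply_def]
  generalize π a = x at *
  generalize π b = y at *
  simp only [ne_eq, Fin.ext_iff, Fin.lt_def] at *
  split_ifs <;> first | omega | norm_num

/-- Transposing two consecutive values alters the comparison of two values only if they are exactly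
those two. -/
lemma descSign_swap_conj_of_not {a b c d : Fin n} (hab : (b : ℕ) = a + 1) (hac : a ≠ c)
    (hbc : b ≠ c) (had : a ≠ d) (hbd : b ≠ d) (hcd : c ≠ d) (π : Perm (Fin n))
    (h : ¬ ((π c = a ∧ π d = b) ∨ (π c = b ∧ π d = a))) :
    descSign c d (swap a b * π * swap a b) = descSign c d π := by
  have hne : π c ≠ π d := fun h => hcd (π.injective h)
  unfold descSign
  simp only [swap_conj_apply, swap_apply_of_ne_of_ne hac.symm hbc.symm,
    swap_apply_of_ne_of_ne had.symm hbd.symm]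
  simp only [swap_apply_def]
  generalize π c = x at *
  generalize π d = y at *
  simp only [ne_eq, Fin.ext_iff, Fin.lt_def] at *
  split_ifs <;> first | omega | norm_num

lemma expect_mul_descSign {a b : Fin n} (hC : ConjClosed C) (hab : (b : ℕ) = a + 1)
    (Y : Perm (Fin n) → ℝ) (hY : ∀ π, Y (swap a b * π * swap a b) = Y π) :
    𝔼 π ∈ C, Y π * descSign a b π = 𝔼 π ∈ C, Y π * pairSign a b π := by
  have h1 := expect_swap_conj hC a b (fun π => Y π * descSign a b π)
  have h2 : 𝔼 π ∈ C, Y π * descSign a b π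
      + 𝔼 π ∈ C, Y (swap a b * π * swap a b) * descSign a b (swap a b * π * swap a b)
      = 2 * 𝔼 π ∈ C, Y π * pairSign a b π := by
    rw [← Finset.expect_add_distrib, Finset.mul_expect]
    refine Finset.expect_congr rfl fun π _ => ?_
    rw [hY]
    linear_combination Y π * descSign_add_swap_conj hab π
  linarith

lemma expect_descSign {a b : Fin n} (hC : ConjClosed C) (hab : (b : ℕ) = a + 1) :
    𝔼 π ∈ C, descSign a b π = 𝔼 π ∈ C, pairSign a b π := by
  simpa using expect_mul_descSign hC hab (fun _ => 1) (fun _ => rfl)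

lemma pairSign_swap_conj {a b c d : Fin n} (hac : a ≠ c)
    (hbc : b ≠ c) (had : a ≠ d) (hbd : b ≠ d) (π : Perm (Fin n)) :
    pairSign a b (swap c d * π * swap c d) = pairSign a b π := by
  have hx : c ∉ ({a, b} : Finset (Fin n)) := by simp [hac.symm, hbc.symm]
  have hy : d ∉ ({a, b} : Finset (Fin n)) := by simp [had.symm, hbd.symm]
  unfold pairSign
  simp only [swap_conj_apply_eq_iff hx hy, mem_insert, mem_singleton, true_or, or_true]

lemma abs_expect_descSign_mul_sub_le {a b c d : Fin n} (hC : ConjClosed C) (hne : C.Nonempty)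
    (hn : 4 ≤ n) (hab : (b : ℕ) = a + 1) (hcd : (d : ℕ) = c + 1)
    (hac : a ≠ c) (hbc : b ≠ c) (had : a ≠ d) (hbd : b ≠ d) :
    |𝔼 π ∈ C, descSign a b π * descSign c d π - 𝔼 π ∈ C, pairSign a b π * pairSign c d π|
      ≤ 2 / (((n : ℝ) - 1) * (n - 3)) := by
  have hab' : a ≠ b := fun h => by subst h; omega
  have hcd' : c ≠ d := fun h => by subst h; omega
  have hn' : (4 : ℝ) ≤ n := by exact_mod_cast hn
  -- Replacing the second sign is exact, because `pairSign a b` is invariant under conjugation by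
  -- `swap c d`. Only the first replacement produces an error.
  rw [← expect_mul_descSign hC hcd (pairSign a b) (pairSign_swap_conj hac hbc had hbd)]
  have h1 := expect_swap_conj hC a b (fun π => descSign a b π * descSign c d π)
  have h2 : 𝔼 π ∈ C, descSign a b π * descSign c d π - 𝔼 π ∈ C, pairSign a b π * descSign c d π
      = 𝔼 π ∈ C, descSign a b (swap a b * π * swap a b) *
        (descSign c d (swap a b * π * swap a b) - descSign c d π) / 2 := by
    have h3 : 𝔼 π ∈ C, descSign a b π * descSign c d π = 𝔼 π ∈ C, (descSign a b π * descSign c d π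
        + descSign a b (swap a b * π * swap a b) * descSign c d (swap a b * π * swap a b)) / 2 := by
      rw [← Finset.expect_div, Finset.expect_add_distrib, h1]; ring
    rw [h3, ← Finset.expect_sub_distrib]
    refine Finset.expect_congr rfl fun π _ => ?_
    linear_combination (descSign c d π / 2) * descSign_add_swap_conj hab π
  rw [h2]
  have h4 : 𝔼 π ∈ C, (indic (π c = a ∧ π d = b) + indic (π c = b ∧ π d = a))
      ≤ 2 / (((n : ℝ) - 1) * (n - 3)) := by
    have e1 := expect_map_map_le hC hne (by omega) hac.symm hcd' had hbc.symm hab' hbd.symm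
    have e2 := expect_map_map_le hC hne (by omega) hbc.symm hcd' hbd hac.symm hab'.symm had.symm
    rw [le_div_iff₀ (by nlinarith), Finset.expect_add_distrib]
    linarith
  refine (Finset.abs_expect_le _ _).trans (le_trans (Finset.expect_le_expect fun π _ => ?_) h4)
  by_cases h : (π c = a ∧ π d = b) ∨ (π c = b ∧ π d = a)
  · have h5 : 1 ≤ indic (π c = a ∧ π d = b) + indic (π c = b ∧ π d = a) := by
      rw [← indic_true h]; exact indic_or_le _ _
    refine le_trans ?_ h5
    rw [abs_div, abs_mul, abs_descSign, abs_two]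
    have := abs_sub (descSign c d (swap a b * π * swap a b)) (descSign c d π)
    rw [abs_descSign, abs_descSign] at this
    linarith
  · rw [descSign_swap_conj_of_not hab hac hbc had hbd hcd' π h]
    simp only [sub_self, mul_zero, zero_div, abs_zero]
    exact add_nonneg (indic_nonneg _) (indic_nonneg _)

set_option maxHeartbeats 1000000 in
/-- The sum over the conjugates by the powers of a 3-cycle of consecutive points. -/
lemma descSign_cyclic_sum {a b c : Fin n} (hab : (b : ℕ) = a + 1) (hbc : (c : ℕ) = b + 1)
    (π : Perm (Fin n))
    (h : ¬ (π a = b ∨ π a = c ∨ π b = a ∨ π b = c ∨ π c = a ∨ π c = b)) :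
    descSign a b π * descSign b c π
      + descSign a b (swap b c * (swap a b * π * swap a b) * swap b c)
        * descSign b c (swap b c * (swap a b * π * swap a b) * swap b c)
      + descSign a b (swap a b * (swap b c * π * swap b c) * swap a b)
        * descSign b c (swap a b * (swap b c * π * swap b c) * swap a b)
      = -1 + 4 * indic (π a = a ∧ π b = b ∧ π c = c) := by
  have hab' : a ≠ b := fun h => by subst h; omega
  have hbc' : b ≠ c := fun h => by subst h; omega
  have hac' : a ≠ c := fun h => by subst h; omega
  have hxy : π a ≠ π b := fun h => hab' (π.injective h)
  have hyz : π b ≠ π c := fun h => hbc' (π.injective h)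
  have hxz : π a ≠ π c := fun h => hac' (π.injective h)
  unfold descSign indic
  simp only [swap_conj_apply, swap_apply_left, swap_apply_right,
    swap_apply_of_ne_of_ne hab' hac', swap_apply_of_ne_of_ne hac'.symm hbc'.symm]
  generalize π a = x at *
  generalize π b = y at *
  generalize π c = z at *
  simp only [not_or] at h
  obtain ⟨h1, h2, h3, h4, h5, h6⟩ := h
  have out : ∀ w : Fin n, w ≠ a → w ≠ b → w ≠ c →
      swap b c (swap a b w) = w ∧ swap a b (swap b c w) = w := by
    intro w ha hb hc
    rw [swap_apply_of_ne_of_ne ha hb, swap_apply_of_ne_of_ne hb hc, swap_apply_of_ne_of_ne ha hb]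
    exact ⟨rfl, rfl⟩
  have ea : swap b c (swap a b a) = c ∧ swap a b (swap b c a) = b := by
    rw [swap_apply_left, swap_apply_left, swap_apply_of_ne_of_ne hab' hac', swap_apply_left]
    exact ⟨rfl, rfl⟩
  have eb : swap b c (swap a b b) = a ∧ swap a b (swap b c b) = c := by
    rw [swap_apply_right, swap_apply_left, swap_apply_of_ne_of_ne hab' hac',
      swap_apply_of_ne_of_ne hac'.symm hbc'.symm]
    exact ⟨rfl, rfl⟩
  have ec : swap b c (swap a b c) = b ∧ swap a b (swap b c c) = a := by
    rw [swap_apply_right, swap_apply_right, swap_apply_of_ne_of_ne hac'.symm hbc'.symm,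
      swap_apply_right]
    exact ⟨rfl, rfl⟩
  -- By `h`, each of the three points is fixed or leaves the triple. With at most one fixed, the
  -- three conjugates show the cyclic rotations of one pattern; exactly one is monotone, so the
  -- products sum to 1 - 1 - 1. Two fixed points give the same sum, three give 3.
  by_cases hx : x = a <;> by_cases hy : y = b <;> by_cases hz : z = c
  all_goals
    try have ox := out x hx h1 h2
    try have oy := out y h3 hy h4
    try have oz := out z h5 h6 hz
    simp only [*, and_true, and_false, and_self, ↓reduceIte]
    clear out ea eb ec
    simp only [ne_eq, Fin.ext_iff, Fin.lt_def] at *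
    split_ifs <;> first | omega | norm_num

lemma abs_expect_descSign_adjacent_le {a b c : Fin n} (hC : ConjClosed C) (hne : C.Nonempty)
    (hab : (b : ℕ) = a + 1) (hbc : (c : ℕ) = b + 1) :
    |𝔼 π ∈ C, descSign a b π * descSign b c π
        - (-1 / 3 + 4 / 3 * 𝔼 π ∈ C, indic (π a = a ∧ π b = b ∧ π c = c))|
      ≤ 16 / ((n : ℝ) - 1) := by
  have hab' : a ≠ b := fun h => by subst h; omega
  have hbc' : b ≠ c := fun h => by subst h; omega
  have hac' : a ≠ c := fun h => by subst h; omega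
  have hn : 3 ≤ n := by have := c.isLt; omega
  have hn' : (3 : ℝ) ≤ n := by exact_mod_cast hn
  have hpos : (0 : ℝ) < n - 1 := by linarith
  set f : Perm (Fin n) → ℝ := fun π => descSign a b π * descSign b c π with hf
  have hfabs : ∀ π, |f π| = 1 := fun π => by simp only [hf, abs_mul, abs_descSign, mul_one]
  have h1 : 𝔼 π ∈ C, f (swap b c * (swap a b * π * swap a b) * swap b c) = 𝔼 π ∈ C, f π := by
    rw [expect_swap_conj hC a b (fun π => f (swap b c * π * swap b c)), expect_swap_conj hC]
  have h2 : 𝔼 π ∈ C, f (swap a b * (swap b c * π * swap b c) * swap a b) = 𝔼 π ∈ C, f π := by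
    rw [expect_swap_conj hC b c (fun π => f (swap a b * π * swap a b)), expect_swap_conj hC]
  have h3 : 𝔼 π ∈ C, f π
        - (-1 / 3 + 4 / 3 * 𝔼 π ∈ C, indic (π a = a ∧ π b = b ∧ π c = c))
      = 𝔼 π ∈ C, ((f π + f (swap b c * (swap a b * π * swap a b) * swap b c)
        + f (swap a b * (swap b c * π * swap b c) * swap a b))
        - (-1 + 4 * indic (π a = a ∧ π b = b ∧ π c = c))) / 3 := by
    rw [← Finset.expect_div, Finset.expect_sub_distrib, Finset.expect_add_distrib,
      Finset.expect_add_distrib, Finset.expect_add_distrib, h1, h2, Finset.expect_const hne,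
      ← Finset.mul_expect]
    ring
  rw [h3]
  -- On the exceptional event the integrand is at most 2 in absolute value, so 8/3 suffices. Six
  -- events of probability at most 1/(n - 1) give 16/(n - 1).
  have h4 : 𝔼 π ∈ C, 8 / 3 * (indic (π a = b) + (indic (π a = c) + (indic (π b = a)
      + (indic (π b = c) + (indic (π c = a) + indic (π c = b)))))) ≤ 16 / ((n : ℝ) - 1) := by
    rw [le_div_iff₀ hpos, ← Finset.mul_expect]
    simp only [Finset.expect_add_distrib]
    have e1 := expect_map_le hC hne hab'
    have e2 := expect_map_le hC hne hac'
    have e3 := expect_map_le hC hne hab'.symm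
    have e4 := expect_map_le hC hne hbc'
    have e5 := expect_map_le hC hne hac'.symm
    have e6 := expect_map_le hC hne hbc'.symm
    linarith
  refine (Finset.abs_expect_le _ _).trans (le_trans (Finset.expect_le_expect fun π _ => ?_) h4)
  by_cases h : π a = b ∨ π a = c ∨ π b = a ∨ π b = c ∨ π c = a ∨ π c = b
  · have h5 : 1 ≤ indic (π a = b) + (indic (π a = c) + (indic (π b = a)
        + (indic (π b = c) + (indic (π c = a) + indic (π c = b))))) := by
      rw [← indic_true h]
      iterate 4 refine (indic_or_le _ _).trans (add_le_add le_rfl ?_)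
      exact indic_or_le _ _
    refine le_trans ?_ (mul_le_mul_of_nonneg_left h5 (by norm_num))
    have b1 := abs_le.1 (hfabs π).le
    have b2 := abs_le.1 (hfabs (swap b c * (swap a b * π * swap a b) * swap b c)).le
    have b3 := abs_le.1 (hfabs (swap a b * (swap b c * π * swap b c) * swap a b)).le
    have b4 := indic_nonneg (π a = a ∧ π b = b ∧ π c = c)
    have b5 := indic_le_one (π a = a ∧ π b = b ∧ π c = c)
    rw [abs_le]
    constructor <;> linarith
  · rw [hf]
    simp only []
    rw [descSign_cyclic_sum hab hbc π h, sub_self, zero_div, abs_zero]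
    refine mul_nonneg (by norm_num) ?_
    have := fun P => indic_nonneg P
    repeat' apply add_nonneg
    all_goals exact this _

end Signs

/-! ### Correlations of disjoint pair signs -/

section Moments

variable {n : ℕ} {C : Finset (Perm (Fin n))}

lemma expect_indic_le_one (hne : C.Nonempty) (P : Perm (Fin n) → Prop) :
    𝔼 π ∈ C, indic (P π) ≤ 1 := by
  calc 𝔼 π ∈ C, indic (P π) ≤ 𝔼 π ∈ C, (1 : ℝ) :=
        Finset.expect_le_expect fun π _ => indic_le_one _
    _ = 1 := Finset.expect_const hne 1

lemma expect_indic_nonneg (P : Perm (Fin n) → Prop) : 0 ≤ 𝔼 π ∈ C, indic (P π) :=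
  Finset.expect_nonneg fun _ _ => indic_nonneg _

/-- In the expanded product, the four-fixed-points term and the two mixed terms are known exactly;
only the double exchange is estimated. -/
lemma abs_expect_pairSign_mul_sub_le {F q : ℝ} {a b c d : Fin n} (hC : ConjClosed C)
    (hne : C.Nonempty) (hF : ∀ π ∈ C, fixCount π = F)
    (hq : ∀ a b : Fin n, a ≠ b → 𝔼 π ∈ C, indic (π a = b ∧ π b = a) = q) (hn : 4 ≤ n)
    (hab : a ≠ b) (hac : a ≠ c) (hbc : b ≠ c) (had : a ≠ d) (hbd : b ≠ d) (hcd : c ≠ d) :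
    |𝔼 π ∈ C, pairSign a b π * pairSign c d π
        - (F * (F - 1) * (F - 2) * (F - 3) / ((n : ℝ) * (n - 1) * (n - 2) * (n - 3))
          - 2 * (F * (F - 1) * q / (((n : ℝ) - 2) * (n - 3))))|
      ≤ 1 / (((n : ℝ) - 1) * (n - 3)) := by
  have hn' : (4 : ℝ) ≤ n := by exact_mod_cast hn
  have h4 := expect_fixed_four hC hne hF hab hac hbc had hbd hcd
  have hr := expect_fixed_fixed_swapped hC hF hab hac hbc had hbd hcd
  have hr' := expect_fixed_fixed_swapped hC hF hcd hac.symm had.symm hbc.symm hbd.symm hab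
  rw [hq c d hcd] at hr
  rw [hq a b hab] at hr'
  have hs := expect_map_map_le hC hne (by omega) hab hac hbc had hbd hcd
  have p0 : (0 : ℝ) < n := by linarith
  have p1 : (0 : ℝ) < (n : ℝ) - 1 := by linarith
  have p2 : (0 : ℝ) < (n : ℝ) - 2 := by linarith
  have p3 : (0 : ℝ) < (n : ℝ) - 3 := by linarith
  have e4 := eq_div_of_mul_eq (by positivity) ((mul_comm _ _).trans h4)
  have er := eq_div_of_mul_eq (by positivity) ((mul_comm _ _).trans hr)
  have er' := eq_div_of_mul_eq (by positivity) ((mul_comm _ _).trans hr')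
  have es := (le_div_iff₀' (by positivity)).2 hs
  have key : 𝔼 π ∈ C, pairSign a b π * pairSign c d π
      = 𝔼 π ∈ C, indic (π a = b ∧ π b = a) * indic (π c = d ∧ π d = c)
        - 𝔼 π ∈ C, indic (π c = c ∧ π d = d) * indic (π a = b ∧ π b = a)
        - 𝔼 π ∈ C, indic (π a = a ∧ π b = b) * indic (π c = d ∧ π d = c)
        + 𝔼 π ∈ C, indic (π a = a ∧ π b = b ∧ π c = c ∧ π d = d) := by
    rw [← Finset.expect_sub_distrib, ← Finset.expect_sub_distrib, ← Finset.expect_add_distrib]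
    refine Finset.expect_congr rfl fun π _ => ?_
    rw [← and_assoc, ← indic_mul (π a = a ∧ π b = b)]
    unfold pairSign
    ring
  have hs1 : 𝔼 π ∈ C, indic (π a = b ∧ π b = a) * indic (π c = d ∧ π d = c)
      ≤ 𝔼 π ∈ C, indic (π a = b ∧ π c = d) := by
    refine Finset.expect_le_expect fun π _ => ?_
    rw [indic_mul]
    exact indic_mono fun h => ⟨h.1.1, h.2.1⟩
  have hs0 : 0 ≤ 𝔼 π ∈ C, indic (π a = b ∧ π b = a) * indic (π c = d ∧ π d = c) :=
    Finset.expect_nonneg fun π _ => mul_nonneg (indic_nonneg _) (indic_nonneg _)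
  rw [key, e4, er, er', abs_le]
  constructor <;> linarith

end Moments

/-! ### Variance of descents minus ascents -/

lemma sum_sum_consecutive (m : ℕ) :
    ∑ i : Fin (m + 1), ∑ j : Fin (m + 1), (if (j : ℕ) = i + 1 then (1 : ℝ) else 0) = m := by
  rw [Finset.sum_comm, Fin.sum_univ_succ]
  have h0 : ∑ i : Fin (m + 1), (if ((0 : Fin (m + 1)) : ℕ) = i + 1 then (1 : ℝ) else 0) = 0 :=
    Finset.sum_eq_zero fun i _ => if_neg (by simp)
  have h1 : ∀ k : Fin m, ∑ i : Fin (m + 1), (if (k.succ : ℕ) = i + 1 then (1 : ℝ) else 0) = 1 := by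
    intro k
    rw [Finset.sum_eq_single k.castSucc]
    · simp
    · intro i _ hi
      refine if_neg fun h => hi (Fin.ext ?_)
      simpa using h.symm
    · simp
  rw [h0, Finset.sum_congr rfl fun k _ => h1 k]
  simp

/-- Summing an array whose entries are nearly constant off and next to the diagonal. -/
lemma abs_sum_sum_sub_le {m : ℕ} (g : Fin (m + 1) → Fin (m + 1) → ℝ) {A B a b : ℝ}
    (ha : 0 ≤ a) (hdiag : ∀ i, g i i = 1)
    (hsymm : ∀ i j, g i j = g j i)
    (hadj : ∀ i j : Fin (m + 1), (j : ℕ) = i + 1 → |g i j - B| ≤ b)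
    (hfar : ∀ i j : Fin (m + 1), (i : ℕ) + 1 < j → |g i j - A| ≤ a) :
    |∑ i, ∑ j, g i j - (((m : ℝ) + 1) ^ 2 * A + (m + 1) * (1 - A) + 2 * m * (B - A))|
      ≤ ((m : ℝ) + 1) ^ 2 * a + 2 * m * b := by
  set D : Fin (m + 1) → Fin (m + 1) → ℝ := fun i j => if i = j then 1 else 0 with hD
  set U : Fin (m + 1) → Fin (m + 1) → ℝ := fun i j => if (j : ℕ) = i + 1 then 1 else 0 with hU
  have hUs : ∑ i, ∑ j, U i j = m := sum_sum_consecutive m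
  have hUs' : ∑ i, ∑ j, U j i = m := by rw [Finset.sum_comm]; exact hUs
  have hDs : ∑ i, ∑ j, D i j = m + 1 := by simp [hD]
  have lin : ∀ x y z : ℝ, ∑ i, ∑ j, (x + D i j * y + (U i j + U j i) * z)
      = ((m : ℝ) + 1) ^ 2 * x + (m + 1) * y + 2 * m * z := by
    intro x y z
    simp only [Finset.sum_add_distrib, ← Finset.sum_mul, hUs, hUs', hDs, Finset.sum_const,
      Finset.card_univ, Fintype.card_fin, nsmul_eq_mul]
    push_cast
    ring
  rw [← lin, ← Finset.sum_sub_distrib]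
  -- The same identity sums the entrywise errors: `a` everywhere and an extra `b` next to the
  -- diagonal.
  have lin' := lin a 0 b
  simp only [mul_zero, add_zero] at lin'
  rw [← lin']
  refine (Finset.abs_sum_le_sum_abs _ _).trans (Finset.sum_le_sum fun i _ => ?_)
  rw [← Finset.sum_sub_distrib]
  refine (Finset.abs_sum_le_sum_abs _ _).trans (Finset.sum_le_sum fun j _ => ?_)
  rcases lt_trichotomy i j with hij | hij | hij
  · have e1 : D i j = 0 := if_neg hij.ne
    have e2 : U j i = 0 := if_neg (by have := Fin.lt_def.1 hij; omega)
    by_cases h : (j : ℕ) = i + 1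
    · have e3 : U i j = 1 := if_pos h
      rw [e1, e2, e3]
      have := hadj i j h
      have e : g i j - (A + 0 * (1 - A) + (1 + 0) * (B - A)) = g i j - B := by ring
      rw [e]; linarith
    · have e3 : U i j = 0 := if_neg h
      rw [e1, e2, e3]
      have := hfar i j (by have := Fin.lt_def.1 hij; omega)
      have e : g i j - (A + 0 * (1 - A) + (0 + 0) * (B - A)) = g i j - A := by ring
      rw [e]; linarith
  · subst hij
    have e1 : D i i = 1 := if_pos rfl
    have e2 : U i i = 0 := if_neg (by omega)
    rw [e1, e2, hdiag]
    have e : (1 : ℝ) - (A + 1 * (1 - A) + (0 + 0) * (B - A)) = 0 := by ring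
    rw [e, abs_zero]; linarith
  · have e1 : D i j = 0 := if_neg hij.ne'
    have e2 : U i j = 0 := if_neg (by have := Fin.lt_def.1 hij; omega)
    rw [hsymm]
    by_cases h : (i : ℕ) = j + 1
    · have e3 : U j i = 1 := if_pos h
      rw [e1, e2, e3]
      have := hadj j i h
      have e : g j i - (A + 0 * (1 - A) + (0 + 1) * (B - A)) = g j i - B := by ring
      rw [e]; linarith
    · have e3 : U j i = 0 := if_neg h
      rw [e1, e2, e3]
      have := hfar j i (by have := Fin.lt_def.1 hij; omega)
      have e : g j i - (A + 0 * (1 - A) + (0 + 0) * (B - A)) = g j i - A := by ring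
      rw [e]; linarith

/-- Descents minus ascents. -/
noncomputable def descExcess {m : ℕ} (π : Perm (Fin (m + 1))) : ℝ :=
  ∑ i : Fin m, descSign i.castSucc i.succ π

/-- The leading part of the variance of `descExcess` on a class with `F` fixed points. -/
noncomputable def mainVariance (n F : ℝ) : ℝ :=
  (n - 1) + 2 * (n - 2) * (-1 / 3 + 4 / 3 * (F * (F - 1) * (F - 2) / (n * (n - 1) * (n - 2))))
    + F * (F - 1) * (F - 2) * (F - 3) / (n * (n - 1)) - (F * (F - 1) / n) ^ 2

/-- The disjoint term has total weight (n - 2)(n - 3), which clears its denominators. The mixed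
terms then give -2F(F - 1)q, while the cross term of the squared mean gives +2(n - 1)F(F - 1)q/n.
What remains is bounded because (n - 1)q ≤ 1. -/
lemma second_moment_identity {n : ℝ} (q F : ℝ) (h0 : 0 < n) (h1 : 0 < n - 1) (h2 : 0 < n - 2)
    (h3 : 0 < n - 3) :
    (n - 1) ^ 2 * (F * (F - 1) * (F - 2) * (F - 3) / (n * (n - 1) * (n - 2) * (n - 3))
          - 2 * (F * (F - 1) * q / ((n - 2) * (n - 3))))
      + (n - 1) * (1 - (F * (F - 1) * (F - 2) * (F - 3) / (n * (n - 1) * (n - 2) * (n - 3))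
          - 2 * (F * (F - 1) * q / ((n - 2) * (n - 3)))))
      + 2 * (n - 2) * (-1 / 3 + 4 / 3 * (F * (F - 1) * (F - 2) / (n * (n - 1) * (n - 2)))
        - (F * (F - 1) * (F - 2) * (F - 3) / (n * (n - 1) * (n - 2) * (n - 3))
          - 2 * (F * (F - 1) * q / ((n - 2) * (n - 3)))))
      - ((n - 1) * (q - F * (F - 1) / (n * (n - 1)))) ^ 2 - mainVariance n F
      = - (2 * (n - 1) * (F * (F - 1) / (n * (n - 1))) * q) - ((n - 1) * q) ^ 2 := by
  unfold mainVariance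
  have e4 : F * (F - 1) * (F - 2) * (F - 3) / (n * (n - 1))
      = (n - 2) * (n - 3) *
        (F * (F - 1) * (F - 2) * (F - 3) / (n * (n - 1) * (n - 2) * (n - 3))) := by
    field_simp
  have er : F * (F - 1) * q = (n - 2) * (n - 3) * (F * (F - 1) * q / ((n - 2) * (n - 3))) := by
    field_simp
  have e2 : F * (F - 1) / n = (n - 1) * (F * (F - 1) / (n * (n - 1))) := by
    field_simp
  have e2' : F * (F - 1) = n * (n - 1) * (F * (F - 1) / (n * (n - 1))) := by
    field_simp
  rw [e4, e2]
  generalize F * (F - 1) * (F - 2) * (F - 3) / (n * (n - 1) * (n - 2) * (n - 3)) = x4 at *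
  generalize F * (F - 1) * q / ((n - 2) * (n - 3)) = r at *
  generalize F * (F - 1) * (F - 2) / (n * (n - 1) * (n - 2)) = x3 at *
  generalize F * (F - 1) / (n * (n - 1)) = x2 at *
  linear_combination 2 * er - 2 * q * e2'

lemma abs_variance_descExcess_sub_le {m : ℕ} (hm : 2 ≤ m) {C : Finset (Perm (Fin (m + 2)))}
    (hC : ConjClosed C) (hne : C.Nonempty) {F : ℝ} (hF : ∀ π ∈ C, fixCount π = F) :
    |𝔼 π ∈ C, descExcess π ^ 2 - (𝔼 π ∈ C, descExcess π) ^ 2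
      - mainVariance ((m + 2 : ℕ) : ℝ) F| ≤ 50 := by
  have hm' : (2 : ℝ) ≤ m := by exact_mod_cast hm
  set n : ℝ := ((m + 2 : ℕ) : ℝ) with hn
  have hnm : n = m + 2 := by rw [hn]; push_cast; ring
  set q : ℝ := 𝔼 π ∈ C, indic (π 0 = 1 ∧ π 1 = 0) with hqdef
  have hq : ∀ a b : Fin (m + 2), a ≠ b → 𝔼 π ∈ C, indic (π a = b ∧ π b = a) = q := fun a b hab =>
    expect_swapped_eq hC (by omega) hab (by simp)
  set p : ℝ := 𝔼 π ∈ C, indic (π 0 = 0 ∧ π 1 = 1) with hpdef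
  have hp : n * (n - 1) * p = F * (F - 1) := expect_fixed_two hC hne hF (by simp)
  have hp0 : 0 ≤ p := expect_indic_nonneg _
  have hp1 : p ≤ 1 := expect_indic_le_one hne _
  have hq0 : 0 ≤ q := expect_indic_nonneg _
  have hq1 : (n - 1) * q ≤ 1 := by
    refine le_trans (mul_le_mul_of_nonneg_left ?_ (by linarith))
      (expect_map_le hC hne (a := 0) (b := 1) (by simp))
    exact Finset.expect_le_expect fun π _ => indic_mono fun h => h.1
  have hN : (0 : ℝ) < n * (n - 1) := by nlinarith
  have hmean : 𝔼 π ∈ C, descExcess π = (n - 1) * (q - p) := by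
    unfold descExcess
    rw [Finset.expect_sum_comm]
    have : ∀ i : Fin (m + 1), 𝔼 π ∈ C, descSign i.castSucc i.succ π = q - p := by
      intro i
      have hi : i.castSucc ≠ i.succ := (Fin.castSucc_lt_succ).ne
      rw [expect_descSign hC (by simp)]
      unfold pairSign
      rw [Finset.expect_sub_distrib, hq _ _ hi]
      congr 1
      refine mul_left_cancel₀ hN.ne' ?_
      rw [hp]
      exact expect_fixed_two hC hne hF hi
    rw [Finset.sum_congr rfl fun i _ => this i]
    simp only [Finset.sum_const, Finset.card_univ, Fintype.card_fin, nsmul_eq_mul]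
    rw [hnm]; push_cast; ring
  set A : ℝ := F * (F - 1) * (F - 2) * (F - 3) / (n * (n - 1) * (n - 2) * (n - 3))
          - 2 * (F * (F - 1) * q / ((n - 2) * (n - 3))) with hA
  set B : ℝ := -1 / 3 + 4 / 3 * (F * (F - 1) * (F - 2) / (n * (n - 1) * (n - 2))) with hB
  have hsq : 𝔼 π ∈ C, descExcess π ^ 2 = ∑ i : Fin (m + 1), ∑ j : Fin (m + 1),
      𝔼 π ∈ C, descSign i.castSucc i.succ π * descSign j.castSucc j.succ π := by
    simp only [← Finset.expect_sum_comm]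
    refine Finset.expect_congr rfl fun π _ => ?_
    rw [descExcess, sq, Finset.sum_mul_sum]
  have hsum := abs_sum_sum_sub_le (m := m) (fun i j =>
      𝔼 π ∈ C, descSign i.castSucc i.succ π * descSign j.castSucc j.succ π)
    (A := A) (B := B) (a := 3 / ((n - 1) * (n - 3))) (b := 16 / (n - 1))
    (div_nonneg (by norm_num) (by nlinarith))
    (by
      intro i
      simp only [descSign_mul_self]
      exact Finset.expect_const hne 1)
    (by
      intro i j
      exact Finset.expect_congr rfl fun π _ => mul_comm _ _)
    (by
      intro i j hij
      have e : j.castSucc = i.succ := Fin.ext (by simpa using hij)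
      have h1 : i.castSucc ≠ i.succ := (Fin.castSucc_lt_succ).ne
      have h2 : i.succ ≠ j.succ := by rw [← e]; exact (Fin.castSucc_lt_succ).ne
      have h3 : i.castSucc ≠ j.succ := fun h => by
        have := congrArg Fin.val h; simp at this; omega
      have := abs_expect_descSign_adjacent_le hC hne (a := i.castSucc) (b := i.succ) (c := j.succ)
        (by simp) (by simp [hij])
      have h3' := expect_fixed_three hC hne hF h1 h3 h2
      rw [eq_div_of_mul_eq _ ((mul_comm _ _).trans h3')] at this
      · simpa only [e] using this
      · have : 0 < n * (n - 1) * (n - 2) := mul_pos hN (by linarith)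
        exact this.ne')
    (by
      intro i j hij
      have h1 : i.castSucc ≠ i.succ := (Fin.castSucc_lt_succ).ne
      have h2 : j.castSucc ≠ j.succ := (Fin.castSucc_lt_succ).ne
      have h3 : i.castSucc ≠ j.castSucc := fun h => by
        have := congrArg Fin.val h; simp at this; omega
      have h4 : i.succ ≠ j.castSucc := fun h => by
        have := congrArg Fin.val h; simp at this; omega
      have h5 : i.castSucc ≠ j.succ := fun h => by
        have := congrArg Fin.val h; simp at this; omega
      have h6 : i.succ ≠ j.succ := fun h => by
        have := congrArg Fin.val h; simp at this; omega
      have k1 := abs_expect_descSign_mul_sub_le hC hne (by omega) (a := i.castSucc) (b := i.succ)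
        (c := j.castSucc) (d := j.succ) (by simp) (by simp) h3 h4 h5 h6
      have k2 := abs_expect_pairSign_mul_sub_le hC hne hF hq (by omega) h1 h3 h4 h5 h6 h2
      have k3 := (abs_sub_le _ _ _).trans (add_le_add k1 k2)
      refine k3.trans (le_of_eq ?_)
      change 2 / ((n - 1) * (n - 3)) + 1 / ((n - 1) * (n - 3)) = _
      rw [← add_div]; norm_num)
  rw [← hsq] at hsum
  have p0 : 0 < n := by linarith
  have p1 : 0 < n - 1 := by linarith
  have p2 : 0 < n - 2 := by linarith
  have p3 : 0 < n - 3 := by linarith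
  -- With n = m + 2, the first term is 3(m + 1)/(m - 1) ≤ 9 for m ≥ 2. The terms in q below add at
  -- most 3, within the bound 50.
  have herr : ((m : ℝ) + 1) ^ 2 * (3 / ((n - 1) * (n - 3))) + 2 * m * (16 / (n - 1)) ≤ 41 := by
    have e1 : ((m : ℝ) + 1) ^ 2 * (3 / ((n - 1) * (n - 3))) ≤ 9 := by
      rw [← mul_div_assoc, div_le_iff₀ (by positivity), hnm]; nlinarith
    have e2 : 2 * m * (16 / (n - 1)) ≤ 32 := by
      rw [← mul_div_assoc, div_le_iff₀ (by positivity), hnm]; nlinarith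
    linarith
  have hid : ((m : ℝ) + 1) ^ 2 * A + (m + 1) * (1 - A) + 2 * m * (B - A)
      - ((n - 1) * (q - p)) ^ 2 - mainVariance n F
      = - (2 * (n - 1) * p * q) - ((n - 1) * q) ^ 2 := by
    have hm1 : (m : ℝ) + 1 = n - 1 := by linarith
    have hm2 : (m : ℝ) = n - 2 := by linarith
    rw [hm1, hm2, eq_div_of_mul_eq hN.ne' ((mul_comm _ _).trans hp)]
    exact second_moment_identity q F p0 p1 p2 p3
  rw [hmean]
  have b1 : 0 ≤ (n - 1) * q := by positivity
  have b2 : (n - 1) * q * p ≤ 1 := by nlinarith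
  have b3 : 0 ≤ (n - 1) * q * p := by positivity
  have b4 : ((n - 1) * q) ^ 2 ≤ 1 := by nlinarith
  have b5 : 0 ≤ ((n - 1) * q) ^ 2 := by positivity
  have hs := abs_le.1 (hsum.trans herr)
  rw [abs_le]
  constructor <;> linarith [hs.1, hs.2]

/-! ### Conjugacy classes and their fixed points -/

section CycleClass

variable {n : ℕ} (p : n.Partition)

lemma mem_cycleClass {π : Perm (Fin n)} : π ∈ cycleClass p ↔ π.partition.parts = p.parts := by
  simp [cycleClass]

lemma conjClosed_cycleClass : ConjClosed (cycleClass p) := by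
  intro x y π hπ
  rw [mem_cycleClass] at hπ ⊢
  rw [← hπ]
  have h : IsConj π (swap x y * π * swap x y) :=
    isConj_iff.2 ⟨swap x y, by rw [swap_inv]⟩
  rw [Perm.partition_eq_of_isConj.1 h]

lemma cycleClass_nonempty : (cycleClass p).Nonempty := by
  have hsum : (p.parts.filter fun k => 2 ≤ k).sum
      + (p.parts.filter fun k => ¬ 2 ≤ k).sum = n := by
    rw [← Multiset.sum_add, Multiset.filter_add_not, p.parts_sum]
  -- Parts are positive, so those below 2 are ones: exactly the fixed points with which a cycle type
  -- is padded.
  have hones : (p.parts.filter fun k => ¬ 2 ≤ k)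
      = Multiset.replicate (p.parts.filter fun k => ¬ 2 ≤ k).sum 1 := by
    have h := (Multiset.eq_replicate_card (s := p.parts.filter fun k => ¬ 2 ≤ k) (a := 1)).2 (by
      intro b hb
      rw [Multiset.mem_filter] at hb
      have := p.parts_pos hb.1
      omega)
    have hc : (p.parts.filter fun k => ¬ 2 ≤ k).sum
        = (p.parts.filter fun k => ¬ 2 ≤ k).card := by
      conv_lhs => rw [h]
      simp
    rw [hc]; exact h
  obtain ⟨g, hg⟩ := (Perm.exists_with_cycleType_iff (Fin n)
    (m := p.parts.filter fun k => 2 ≤ k)).2 ⟨by rw [Fintype.card_fin]; omega, by simp⟩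
  refine ⟨g, (mem_cycleClass p).2 ?_⟩
  rw [Perm.parts_partition, ← Perm.sum_cycleType, hg, Fintype.card_fin]
  have : n - (p.parts.filter fun k => 2 ≤ k).sum = (p.parts.filter fun k => ¬ 2 ≤ k).sum := by
    omega
  rw [this, ← hones, Multiset.filter_add_not]

lemma fixCount_eq_partMult {π : Perm (Fin n)} (hπ : π ∈ cycleClass p) :
    fixCount π = partMult p 1 := by
  have h1 : fixCount π = (π.supportᶜ.card : ℝ) := by
    rw [Finset.cast_card, fixCount, ← Finset.sum_subset (Finset.subset_univ π.supportᶜ)]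
    · exact Finset.sum_congr rfl fun x hx => indic_true (by simpa using hx)
    · exact fun x _ hx => indic_false (by simpa using hx)
  rw [h1, partMult, ← (mem_cycleClass p).1 hπ, Perm.parts_partition, Multiset.count_add,
    Multiset.count_replicate_self, Multiset.count_eq_zero_of_notMem, zero_add,
    Finset.card_compl]
  exact fun h => absurd (Perm.two_le_of_mem_cycleType h) (by norm_num)

end CycleClass

/-! ### From the measure-theoretic variance to finite averages -/

lemma integral_uniformOn_finset {Ω : Type*} [Fintype Ω] [MeasurableSpace Ω]
    [MeasurableSingletonClass Ω] (s : Finset Ω) (f : Ω → ℝ) :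
    ∫ x, f x ∂(ProbabilityTheory.uniformOn (s : Set Ω)) = 𝔼 x ∈ s, f x := by
  classical
  rw [MeasureTheory.integral_fintype .of_finite, Finset.expect_eq_sum_div_card, Finset.sum_div,
    ← Finset.sum_filter_add_sum_filter_not Finset.univ (· ∈ s)]
  have h1 : ∀ x, (ProbabilityTheory.uniformOn (s : Set Ω)).real {x}
      = if x ∈ s then (s.card : ℝ)⁻¹ else 0 := by
    intro x
    rw [MeasureTheory.measureReal_def, ← Finset.coe_singleton,
      ProbabilityTheory.uniformOn_apply_finset]
    split_ifs with h
    · rw [Finset.inter_singleton_of_mem h]; simp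
    · rw [Finset.inter_singleton_of_notMem h]; simp
  rw [Finset.sum_eq_zero (s := Finset.univ.filter fun x => ¬ x ∈ s), add_zero]
  · rw [Finset.filter_mem_eq_inter, Finset.univ_inter]
    refine Finset.sum_congr rfl fun x hx => ?_
    rw [h1, if_pos hx, smul_eq_mul, inv_mul_eq_div]
  · intro x hx
    rw [h1, if_neg (Finset.mem_filter.1 hx).2, zero_smul]

lemma descentNumber_eq {m : ℕ} (π : Perm (Fin (m + 1))) :
    (descentNumber π : ℝ) = (1 / 2) * descExcess π + (m : ℝ) / 2 := by
  have h1 : (descentNumber π : ℝ)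
      = ∑ i : Fin m, if π i.succ < π i.castSucc then (1 : ℝ) else 0 := by
    unfold descentNumber descentSet
    -- The last point has no successor, so its summand vanishes.
    rw [Finset.natCast_card_filter, Fin.sum_univ_castSucc, if_neg, add_zero]
    · refine Finset.sum_congr rfl fun i _ => ?_
      refine if_congr ?_ rfl rfl
      constructor
      · rintro ⟨_, h⟩; exact h
      · intro h; exact ⟨by simp, h⟩
    · rintro ⟨h, _⟩
      simp at h
  have h2 : ∀ i : Fin m, (if π i.succ < π i.castSucc then (1 : ℝ) else 0)
      = (1 / 2) * descSign i.castSucc i.succ π + 1 / 2 := by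
    intro i; unfold descSign; split_ifs <;> norm_num
  rw [h1, Finset.sum_congr rfl fun i _ => h2 i, Finset.sum_add_distrib, ← Finset.mul_sum,
    descExcess]
  simp [div_eq_mul_inv]

lemma descentVariance_eq {m : ℕ} (p : (m + 1).Partition) :
    descentVariance p = (1 / 4) * (𝔼 π ∈ cycleClass p, descExcess π ^ 2
      - (𝔼 π ∈ cycleClass p, descExcess π) ^ 2) := by
  let _ : MeasurableSpace (Perm (Fin (m + 1))) := ⊤
  have hprob := ProbabilityTheory.isProbabilityMeasure_uniformOn
    (s := (cycleClass p : Set (Perm (Fin (m + 1))))) (Set.toFinite _)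
    (by exact_mod_cast cycleClass_nonempty p)
  change ProbabilityTheory.variance (fun π : Perm (Fin (m + 1)) => (descentNumber π : ℝ))
    (ProbabilityTheory.uniformOn (cycleClass p : Set (Perm (Fin (m + 1))))) = _
  simp only [descentNumber_eq]
  rw [ProbabilityTheory.variance_add_const
      (measurable_from_top.aestronglyMeasurable),
    ProbabilityTheory.variance_const_mul, ProbabilityTheory.variance_eq_sub .of_discrete,
    integral_uniformOn_finset, integral_uniformOn_finset]
  norm_num

lemma abs_descentVariance_sub_le {n : ℕ} (hn : 4 ≤ n) (p : n.Partition) :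
    |descentVariance p - (1 / 4) * mainVariance n (partMult p 1)| ≤ 13 := by
  obtain ⟨m, rfl⟩ : ∃ m, n = m + 2 := ⟨n - 2, by omega⟩
  have h := abs_variance_descExcess_sub_le (m := m) (by omega) (conjClosed_cycleClass p)
    (cycleClass_nonempty p) (fun π hπ => fixCount_eq_partMult p hπ)
  rw [descentVariance_eq p, ← mul_sub, abs_mul, abs_of_pos (by norm_num : (0 : ℝ) < 1 / 4)]
  linarith

/-! ### The limit -/

/-- The rescaled leading part of the variance, in terms of the fraction `f` of fixed points and
`u = 1 / n`. -/
noncomputable def scaledVariance (f u : ℝ) : ℝ :=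
  (1 - u) + 2 * (1 - 2 * u) * (-1 / 3 + 4 / 3 * (f * (f - u) * (f - 2 * u) /
      ((1 - u) * (1 - 2 * u))))
    + f * (f - u) * ((-4 * f + f ^ 2 + 6 * u - f * u) / (1 - u))

/-- The last two terms of `mainVariance` can each have order n². Their leading parts cancel here,
leaving an expression continuous at u = 0. -/
lemma mainVariance_div {n : ℝ} (hn : 3 ≤ n) (F : ℝ) :
    mainVariance n F / n = scaledVariance (F / n) (1 / n) := by
  have h0 : n ≠ 0 := by linarith
  have h1 : n - 1 ≠ 0 := by linarith
  have h2 : n - 2 ≠ 0 := by linarith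
  have e1 : 1 - 1 / n = (n - 1) / n := by field_simp
  have e2 : 1 - 2 * (1 / n) = (n - 2) / n := by field_simp
  unfold mainVariance scaledVariance
  rw [e1, e2]
  field_simp
  ring

lemma tendsto_scaledVariance {ι : Type*} {l : Filter ι} {f u : ι → ℝ} {α : ℝ}
    (hf : Filter.Tendsto f l (nhds α)) (hu : Filter.Tendsto u l (nhds 0)) :
    Filter.Tendsto (fun k => scaledVariance (f k) (u k)) l
      (nhds ((1 - 4 * α ^ 3 + 3 * α ^ 4) / 3)) := by
  have hc : ContinuousAt (fun x : ℝ × ℝ => scaledVariance x.1 x.2) (α, 0) := by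
    unfold scaledVariance
    fun_prop (disch := norm_num)
  have := hc.tendsto.comp (hf.prodMk_nhds hu)
  have e : scaledVariance α 0 = (1 - 4 * α ^ 3 + 3 * α ^ 4) / 3 := by
    unfold scaledVariance
    ring
  rwa [← e]

theorem mainTheorem4 {ι : Type*} (l : Filter ι) (n : ι → ℕ) (p : ∀ k, (n k).Partition) (α : ℝ)
    (hn : Filter.Tendsto n l Filter.atTop)
    (hα : Filter.Tendsto (fun k => (partMult (p k) 1 : ℝ) / (n k : ℝ)) l (nhds α)) :
    Filter.Tendsto (fun k => descentVariance (p k) / (n k : ℝ)) l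
        (nhds ((1 - 4 * α ^ 3 + 3 * α ^ 4) / 12)) ∧
      (α < 1 → Asymptotics.IsEquivalent l (fun k => descentVariance (p k))
        (fun k => (1 - 4 * α ^ 3 + 3 * α ^ 4) * ((n k : ℝ) / 12))) := by
  have hnR : Filter.Tendsto (fun k => (n k : ℝ)) l Filter.atTop :=
    tendsto_natCast_atTop_atTop.comp hn
  have hu : Filter.Tendsto (fun k => 1 / (n k : ℝ)) l (nhds 0) := by
    simp only [one_div]
    exact hnR.inv_tendsto_atTop
  have hlarge : ∀ᶠ k in l, 4 ≤ n k := hn.eventually_ge_atTop 4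
  have hmain : Filter.Tendsto (fun k => descentVariance (p k) / (n k : ℝ)) l
      (nhds ((1 - 4 * α ^ 3 + 3 * α ^ 4) / 12)) := by
    have h1 := (tendsto_scaledVariance hα hu).const_mul (1 / 4 : ℝ)
    have h2 : Filter.Tendsto (fun k => descentVariance (p k) / (n k : ℝ)
        - 1 / 4 * scaledVariance ((partMult (p k) 1 : ℝ) / (n k : ℝ)) (1 / (n k : ℝ))) l
        (nhds 0) := by
      refine squeeze_zero_norm' ?_ (by simpa using hu.const_mul (13 : ℝ))
      filter_upwards [hlarge] with k hk
      have hk' : (4 : ℝ) ≤ n k := by exact_mod_cast hk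
      rw [← mainVariance_div (by linarith), ← mul_div_assoc, ← sub_div, Real.norm_eq_abs, abs_div,
        abs_of_pos (by linarith : (0 : ℝ) < n k), ← div_eq_mul_inv]
      exact div_le_div_of_nonneg_right (abs_descentVariance_sub_le hk (p k)) (by linarith)
    have h3 := h2.add h1
    simp only [sub_add_cancel] at h3
    convert h3 using 2
    ring
  refine ⟨hmain, fun hα1 => ?_⟩
  -- The second factor is positive for every real α, since three times it equals (1 + 3α)² + 2.
  have hc : 0 < 1 - 4 * α ^ 3 + 3 * α ^ 4 := by
    have : 1 - 4 * α ^ 3 + 3 * α ^ 4 = (1 - α) ^ 2 * ((1 + α) ^ 2 + 2 * α ^ 2) := by ring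
    rw [this]
    have h1 : 0 < 1 - α := by linarith
    have h2 : 0 < (1 + α) ^ 2 + 2 * α ^ 2 := by nlinarith [sq_nonneg (1 + 3 * α)]
    positivity
  refine Asymptotics.isEquivalent_of_tendsto_one ?_
  have h4 := hmain.mul_const (12 / (1 - 4 * α ^ 3 + 3 * α ^ 4))
  have e : (1 - 4 * α ^ 3 + 3 * α ^ 4) / 12 * (12 / (1 - 4 * α ^ 3 + 3 * α ^ 4)) = 1 := by
    rw [div_mul_div_cancel₀' hc.ne', div_self (by norm_num)]
  rw [e] at h4
  refine h4.congr fun k => ?_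
  simp only [Pi.div_apply]
  rw [div_mul_div_comm, mul_div_assoc', div_div_eq_mul_div, mul_comm (n k : ℝ)]
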